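/- Let $R$ be a prime ring (associative, not necessarily with unity) with center $Z(R)$, that is, for $a,b\in R$, $aRb=0$ implies $a=0$ or $b=0$. Let $C$ be the extended centroid of $R$, i.e. the center of the Martindale symmetric ring of quotients $Q_s(R)\supseteq R$. For subsets $A,B$ of a ring, $AB$ (resp. $[A,B]$) denotes the additive subgroup generated by all products $ab$ (resp. all commutators $ab-ba$) with $a\in A$, $b\in B$; in particular $LC$ is the additive subgroup of $Q_s(R)$ generated by all $\ell c$ with $\ell\in L$, $c\in C$, and $Ca+C=\{ca+d : c,d\in C\}\subseteq Q_s(R)$. A Lie ideal of $R$ is an additive subgroup $L$ with $[L,R]\subseteq L$; it is noncentral if $L\not\subseteq Z(R)$. Let $m,n\ge 1$ and let $K_1,\ldots,K_m,L_1,\ldots,L_n$ be noncentral Lie ideals of $R$. Then $[K_1K_2\cdots K_m,\;L_1L_2\cdots L_n]=0$ if and only if, for all $1\le j\le m$, all $1\le k\le n$ and every element $a\in K_1\setminus Z(R)$, one has $$K_1C=K_jC=L_kC=Ca+C.$$ -/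

import Mathlib

open scoped Pointwise

/-- A nonzero associative ring, not necessarily with unity, is *prime* if `a R b = 0` implies
`a = 0` or `b = 0`. -/
class IsPrimeRing (R : Type*) [NonUnitalRing R] : Prop extends Nontrivial R where
  eq_zero_or_eq_zero : ∀ a b : R, (∀ r : R, a * r * b = 0) → a = 0 ∨ b = 0

namespace Martindale

section Ideals

variable {R : Type*} [NonUnitalRing R]

/-- The product `I J` of two ideals: all finite sums of elements `x * y`, `x ∈ I`, `y ∈ J`. -/
def idealMul (I J : TwoSidedIdeal R) : TwoSidedIdeal R :=
  TwoSidedIdeal.mk' (AddSubgroup.closure {z : R | ∃ x ∈ I, ∃ y ∈ J, z = x * y} : Set R)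
    (zero_mem _) (fun hx hy => add_mem hx hy) (fun hx => neg_mem hx)
    (by
      intro x y hy
      change x * y ∈ AddSubgroup.closure _
      refine AddSubgroup.closure_induction (p := fun y _ => x * y ∈ AddSubgroup.closure _)
        ?_ ?_ ?_ ?_ hy
      · rintro _ ⟨u, hu, v, hv, rfl⟩
        exact AddSubgroup.subset_closure
          ⟨x * u, I.mul_mem_left _ _ hu, v, hv, (mul_assoc _ _ _).symm⟩
      · simp
      · intro a b _ _ ha hb
        rw [mul_add]
        exact add_mem ha hb
      · intro a _ ha
        rw [mul_neg]
        exact neg_mem ha)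
    (by
      intro y x hy
      change y * x ∈ AddSubgroup.closure _
      refine AddSubgroup.closure_induction (p := fun y _ => y * x ∈ AddSubgroup.closure _)
        ?_ ?_ ?_ ?_ hy
      · rintro _ ⟨u, hu, v, hv, rfl⟩
        exact AddSubgroup.subset_closure
          ⟨u, hu, v * x, J.mul_mem_right _ _ hv, mul_assoc _ _ _⟩
      · simp
      · intro a b _ _ ha hb
        rw [add_mul]
        exact add_mem ha hb
      · intro a _ ha
        rw [neg_mul]
        exact neg_mem ha)

theorem mem_idealMul {I J : TwoSidedIdeal R} {z : R} :
    z ∈ idealMul I J ↔ z ∈ AddSubgroup.closure {z : R | ∃ x ∈ I, ∃ y ∈ J, z = x * y} := by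
  rw [idealMul, TwoSidedIdeal.mem_mk']
  rfl

theorem mul_mem_idealMul {I J : TwoSidedIdeal R} {x y : R} (hx : x ∈ I) (hy : y ∈ J) :
    x * y ∈ idealMul I J :=
  mem_idealMul.2 (AddSubgroup.subset_closure ⟨x, hx, y, hy, rfl⟩)

theorem idealMul_induction {I J : TwoSidedIdeal R} {p : R → Prop}
    (mul : ∀ x ∈ I, ∀ y ∈ J, p (x * y)) (zero : p 0)
    (add : ∀ x ∈ idealMul I J, ∀ y ∈ idealMul I J, p x → p y → p (x + y))
    (neg : ∀ x ∈ idealMul I J, p x → p (-x))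
    {z : R} (hz : z ∈ idealMul I J) : p z := by
  refine AddSubgroup.closure_induction (p := fun z _ => p z) ?_ zero ?_ ?_ (mem_idealMul.1 hz)
  · rintro _ ⟨u, hu, v, hv, rfl⟩
    exact mul u hu v hv
  · intro a b ha hb
    exact add a (mem_idealMul.2 ha) b (mem_idealMul.2 hb)
  · intro a ha
    exact neg a (mem_idealMul.2 ha)

theorem idealMul_le_left (I J : TwoSidedIdeal R) {z : R} (hz : z ∈ idealMul I J) : z ∈ I :=
  idealMul_induction (p := fun z => z ∈ I) (fun _ hx _ _ => I.mul_mem_right _ _ hx) I.zero_mem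
    (fun _ _ _ _ h h' => I.add_mem h h') (fun _ _ h => I.neg_mem h) hz

theorem idealMul_le_right (I J : TwoSidedIdeal R) {z : R} (hz : z ∈ idealMul I J) : z ∈ J :=
  idealMul_induction (p := fun z => z ∈ J) (fun _ _ _ hy => J.mul_mem_left _ _ hy) J.zero_mem
    (fun _ _ _ _ h h' => J.add_mem h h') (fun _ _ h => J.neg_mem h) hz

theorem idealMul_mono {I I' J J' : TwoSidedIdeal R} (hI : ∀ x ∈ I, x ∈ I')
    (hJ : ∀ x ∈ J, x ∈ J') {z : R} (hz : z ∈ idealMul I J) : z ∈ idealMul I' J' :=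
  idealMul_induction (p := fun z => z ∈ idealMul I' J')
    (fun x hx y hy => mul_mem_idealMul (hI x hx) (hJ y hy)) (TwoSidedIdeal.zero_mem _)
    (fun _ _ _ _ h h' => TwoSidedIdeal.add_mem _ h h')
    (fun _ _ h => TwoSidedIdeal.neg_mem _ h) hz

theorem exists_ne_zero {I : TwoSidedIdeal R} (hI : I ≠ ⊥) : ∃ x ∈ I, x ≠ 0 := by
  by_contra! h
  exact hI (TwoSidedIdeal.ext fun x =>
    ⟨fun hx => (TwoSidedIdeal.mem_bot R).2 (h x hx),
      fun hx => (TwoSidedIdeal.mem_bot R).1 hx ▸ I.zero_mem⟩)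

theorem idealMul_ne_bot [IsPrimeRing R] {I J : TwoSidedIdeal R} (hI : I ≠ ⊥) (hJ : J ≠ ⊥) :
    idealMul I J ≠ ⊥ := by
  obtain ⟨x, hx, hx0⟩ := exists_ne_zero hI
  obtain ⟨y, hy, hy0⟩ := exists_ne_zero hJ
  intro h
  rcases IsPrimeRing.eq_zero_or_eq_zero x y (fun r => by
    have := mul_mem_idealMul (I.mul_mem_right x r hx) hy
    rw [h] at this
    exact (TwoSidedIdeal.mem_bot R).1 this) with h0 | h0
  · exact hx0 h0
  · exact hy0 h0

theorem inf_ne_bot [IsPrimeRing R] {I J : TwoSidedIdeal R} (hI : I ≠ ⊥) (hJ : J ≠ ⊥) :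
    I ⊓ J ≠ ⊥ := by
  obtain ⟨x, hx, hx0⟩ := exists_ne_zero (idealMul_ne_bot hI hJ)
  intro h
  have hm : x ∈ I ⊓ J :=
    (TwoSidedIdeal.mem_inf R).2 ⟨idealMul_le_left _ _ hx, idealMul_le_right _ _ hx⟩
  rw [h] at hm
  exact hx0 ((TwoSidedIdeal.mem_bot R).1 hm)

theorem top_ne_bot [IsPrimeRing R] : (⊤ : TwoSidedIdeal R) ≠ ⊥ := by
  obtain ⟨x, hx⟩ := exists_ne (0 : R)
  intro h
  have hm : x ∈ (⊤ : TwoSidedIdeal R) := TwoSidedIdeal.mem_top R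
  rw [h] at hm
  exact hx ((TwoSidedIdeal.mem_bot R).1 hm)

end Ideals

/-- A balanced pair `(f, g)` on a nonzero ideal `I` of `R`: a homomorphism `f : I → R` of right
`R`-modules (think of `x ↦ q x`) and a homomorphism `g : I → R` of left `R`-modules (think of
`x ↦ x q`), with `g x * y = x * f y` for all `x, y ∈ I`. Only the restrictions of `f` and `g`
to `I` matter: values outside `I` are arbitrary, and are forgotten in the quotient below. -/
structure BalancedPair (R : Type*) [NonUnitalRing R] where
  dom : TwoSidedIdeal R
  dom_ne_bot : dom ≠ ⊥
  left : R → R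
  right : R → R
  left_add : ∀ x ∈ dom, ∀ y ∈ dom, left (x + y) = left x + left y
  right_add : ∀ x ∈ dom, ∀ y ∈ dom, right (x + y) = right x + right y
  left_mul : ∀ x ∈ dom, ∀ r : R, left (x * r) = left x * r
  right_mul : ∀ x ∈ dom, ∀ r : R, right (r * x) = r * right x
  balanced : ∀ x ∈ dom, ∀ y ∈ dom, right x * y = x * left y

namespace BalancedPair

variable {R : Type*} [NonUnitalRing R]

theorem left_zero (q : BalancedPair R) : q.left 0 = 0 := by
  have h := q.left_add 0 q.dom.zero_mem 0 q.dom.zero_mem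
  rw [add_zero] at h
  exact left_eq_add.1 h

theorem right_zero (q : BalancedPair R) : q.right 0 = 0 := by
  have h := q.right_add 0 q.dom.zero_mem 0 q.dom.zero_mem
  rw [add_zero] at h
  exact left_eq_add.1 h

theorem left_neg (q : BalancedPair R) {x : R} (hx : x ∈ q.dom) : q.left (-x) = -q.left x := by
  have h := q.left_add x hx (-x) (q.dom.neg_mem hx)
  rw [add_neg_cancel, left_zero] at h
  exact (neg_eq_of_add_eq_zero_right h.symm).symm

theorem right_neg (q : BalancedPair R) {x : R} (hx : x ∈ q.dom) :
    q.right (-x) = -q.right x := by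
  have h := q.right_add x hx (-x) (q.dom.neg_mem hx)
  rw [add_neg_cancel, right_zero] at h
  exact (neg_eq_of_add_eq_zero_right h.symm).symm

/-- If `J` lies in the domain, then `f (J I) ⊆ I`. -/
theorem left_mem (q : BalancedPair R) {I J : TwoSidedIdeal R} (hJ : ∀ x ∈ J, x ∈ q.dom)
    {z : R} (hz : z ∈ idealMul J I) : q.left z ∈ I := by
  refine idealMul_induction (p := fun z => q.left z ∈ I) ?_ ?_ ?_ ?_ hz
  · intro x hx y hy
    rw [q.left_mul x (hJ x hx)]
    exact I.mul_mem_left _ _ hy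
  · rw [left_zero]
    exact I.zero_mem
  · intro x hx y hy h h'
    rw [q.left_add x (hJ x (idealMul_le_left _ _ hx)) y (hJ y (idealMul_le_left _ _ hy))]
    exact I.add_mem h h'
  · intro x hx h
    rw [q.left_neg (hJ x (idealMul_le_left _ _ hx))]
    exact I.neg_mem h

/-- If `I` lies in the domain, then `g (J I) ⊆ J`. -/
theorem right_mem (q : BalancedPair R) {I J : TwoSidedIdeal R} (hI : ∀ x ∈ I, x ∈ q.dom)
    {z : R} (hz : z ∈ idealMul J I) : q.right z ∈ J := by
  refine idealMul_induction (p := fun z => q.right z ∈ J) ?_ ?_ ?_ ?_ hz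
  · intro x hx y hy
    rw [q.right_mul y (hI y hy)]
    exact J.mul_mem_right _ _ hx
  · rw [right_zero]
    exact J.zero_mem
  · intro x hx y hy h h'
    rw [q.right_add x (hI x (idealMul_le_right _ _ hx)) y (hI y (idealMul_le_right _ _ hy))]
    exact J.add_mem h h'
  · intro x hx h
    rw [q.right_neg (hI x (idealMul_le_right _ _ hx))]
    exact J.neg_mem h

variable [IsPrimeRing R]

/-- The pair of left and right multiplication by an element of `R`. -/
def of (a : R) : BalancedPair R where
  dom := ⊤
  dom_ne_bot := top_ne_bot
  left x := a * x
  right x := x * a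
  left_add _ _ _ _ := mul_add _ _ _
  right_add _ _ _ _ := add_mul _ _ _
  left_mul _ _ _ := (mul_assoc _ _ _).symm
  right_mul _ _ _ := mul_assoc _ _ _
  balanced _ _ _ _ := mul_assoc _ _ _

/-- The pair of identity maps. -/
def one : BalancedPair R where
  dom := ⊤
  dom_ne_bot := top_ne_bot
  left x := x
  right x := x
  left_add _ _ _ _ := rfl
  right_add _ _ _ _ := rfl
  left_mul _ _ _ := rfl
  right_mul _ _ _ := rfl
  balanced _ _ _ _ := rfl

/-- Pointwise negative. -/
def neg (q : BalancedPair R) : BalancedPair R where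
  dom := q.dom
  dom_ne_bot := q.dom_ne_bot
  left x := -q.left x
  right x := -q.right x
  left_add x hx y hy := by rw [q.left_add x hx y hy, neg_add]
  right_add x hx y hy := by rw [q.right_add x hx y hy, neg_add]
  left_mul x hx r := by rw [q.left_mul x hx, neg_mul]
  right_mul x hx r := by rw [q.right_mul x hx, mul_neg]
  balanced x hx y hy := by rw [neg_mul, mul_neg, q.balanced x hx y hy]

/-- Pointwise sum, on the intersection of the domains. -/
def add (q p : BalancedPair R) : BalancedPair R where
  dom := q.dom ⊓ p.dom
  dom_ne_bot := inf_ne_bot q.dom_ne_bot p.dom_ne_bot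
  left x := q.left x + p.left x
  right x := q.right x + p.right x
  left_add x hx y hy := by
    rw [TwoSidedIdeal.mem_inf] at hx hy
    rw [q.left_add x hx.1 y hy.1, p.left_add x hx.2 y hy.2]
    abel
  right_add x hx y hy := by
    rw [TwoSidedIdeal.mem_inf] at hx hy
    rw [q.right_add x hx.1 y hy.1, p.right_add x hx.2 y hy.2]
    abel
  left_mul x hx r := by
    rw [TwoSidedIdeal.mem_inf] at hx
    rw [q.left_mul x hx.1, p.left_mul x hx.2, add_mul]
  right_mul x hx r := by
    rw [TwoSidedIdeal.mem_inf] at hx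
    rw [q.right_mul x hx.1, p.right_mul x hx.2, mul_add]
  balanced x hx y hy := by
    rw [TwoSidedIdeal.mem_inf] at hx hy
    rw [add_mul, mul_add, q.balanced x hx.1 y hy.1, p.balanced x hx.2 y hy.2]

/-- Composition, on the product of the domains. -/
def mul (q p : BalancedPair R) : BalancedPair R where
  dom := idealMul p.dom q.dom
  dom_ne_bot := idealMul_ne_bot p.dom_ne_bot q.dom_ne_bot
  left x := q.left (p.left x)
  right x := p.right (q.right x)
  left_add x hx y hy := by
    rw [p.left_add x (idealMul_le_left _ _ hx) y (idealMul_le_left _ _ hy),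
      q.left_add _ (p.left_mem (fun _ h => h) hx) _ (p.left_mem (fun _ h => h) hy)]
  right_add x hx y hy := by
    rw [q.right_add x (idealMul_le_right _ _ hx) y (idealMul_le_right _ _ hy),
      p.right_add _ (q.right_mem (fun _ h => h) hx) _ (q.right_mem (fun _ h => h) hy)]
  left_mul x hx r := by
    rw [p.left_mul x (idealMul_le_left _ _ hx), q.left_mul _ (p.left_mem (fun _ h => h) hx)]
  right_mul x hx r := by
    rw [q.right_mul x (idealMul_le_right _ _ hx), p.right_mul _ (q.right_mem (fun _ h => h) hx)]
  balanced x hx y hy := by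
    rw [p.balanced _ (q.right_mem (fun _ h => h) hx) _ (idealMul_le_left _ _ hy),
      q.balanced _ (idealMul_le_right _ _ hx) _ (p.left_mem (fun _ h => h) hy)]

/-- Two balanced pairs are identified if they agree on some nonzero ideal contained in both
domains. -/
def Rel (q p : BalancedPair R) : Prop :=
  ∃ K : TwoSidedIdeal R, K ≠ ⊥ ∧
    ∀ x ∈ K, x ∈ q.dom ∧ x ∈ p.dom ∧ q.left x = p.left x ∧ q.right x = p.right x

theorem rel_of_eqOn {q p : BalancedPair R}
    (h : ∀ x ∈ q.dom, x ∈ p.dom → q.left x = p.left x ∧ q.right x = p.right x) : Rel q p :=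
  ⟨q.dom ⊓ p.dom, inf_ne_bot q.dom_ne_bot p.dom_ne_bot, fun x hx =>
    have hx := (TwoSidedIdeal.mem_inf R).1 hx
    ⟨hx.1, hx.2, h x hx.1 hx.2⟩⟩

instance setoid (R : Type*) [NonUnitalRing R] [IsPrimeRing R] : Setoid (BalancedPair R) where
  r := Rel
  iseqv :=
    { refl := fun _ => rel_of_eqOn fun _ _ _ => ⟨rfl, rfl⟩
      symm := by
        rintro q p ⟨K, hK, h⟩
        exact ⟨K, hK, fun x hx => ⟨(h x hx).2.1, (h x hx).1, (h x hx).2.2.1.symm,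
          (h x hx).2.2.2.symm⟩⟩
      trans := by
        rintro q p s ⟨K, hK, h⟩ ⟨K', hK', h'⟩
        refine ⟨K ⊓ K', inf_ne_bot hK hK', fun x hx => ?_⟩
        rw [TwoSidedIdeal.mem_inf] at hx
        obtain ⟨h1, -, h2, h3⟩ := h x hx.1
        obtain ⟨-, h4, h5, h6⟩ := h' x hx.2
        exact ⟨h1, h4, h2.trans h5, h3.trans h6⟩ }

theorem rel_neg {q p : BalancedPair R} (h : q ≈ p) : neg q ≈ neg p := by
  obtain ⟨K, hK, h⟩ := h
  refine ⟨K, hK, fun x hx => ?_⟩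
  obtain ⟨h1, h2, h3, h4⟩ := h x hx
  exact ⟨h1, h2, congrArg Neg.neg h3, congrArg Neg.neg h4⟩

theorem rel_add {q p q' p' : BalancedPair R} (h : q ≈ p) (h' : q' ≈ p') :
    add q q' ≈ add p p' := by
  obtain ⟨K, hK, h⟩ := h
  obtain ⟨K', hK', h'⟩ := h'
  refine ⟨K ⊓ K', inf_ne_bot hK hK', fun x hx => ?_⟩
  rw [TwoSidedIdeal.mem_inf] at hx
  obtain ⟨h1, h2, h3, h4⟩ := h x hx.1
  obtain ⟨h1', h2', h3', h4'⟩ := h' x hx.2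
  exact ⟨(TwoSidedIdeal.mem_inf R).2 ⟨h1, h1'⟩, (TwoSidedIdeal.mem_inf R).2 ⟨h2, h2'⟩,
    congrArg₂ (· + ·) h3 h3', congrArg₂ (· + ·) h4 h4'⟩

theorem rel_mul {q p q' p' : BalancedPair R} (h : q ≈ p) (h' : q' ≈ p') :
    mul q q' ≈ mul p p' := by
  obtain ⟨K, hK, h⟩ := h
  obtain ⟨K', hK', h'⟩ := h'
  refine ⟨idealMul K' K, idealMul_ne_bot hK' hK, fun x hx => ⟨?_, ?_, ?_, ?_⟩⟩
  · exact idealMul_mono (fun y hy => (h' y hy).1) (fun y hy => (h y hy).1) hx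
  · exact idealMul_mono (fun y hy => (h' y hy).2.1) (fun y hy => (h y hy).2.1) hx
  · change q.left (q'.left x) = p.left (p'.left x)
    rw [(h _ (q'.left_mem (fun y hy => (h' y hy).1) hx)).2.2.1,
      (h' x (idealMul_le_left _ _ hx)).2.2.1]
  · change q'.right (q.right x) = p'.right (p.right x)
    rw [(h' _ (q.right_mem (fun y hy => (h y hy).1) hx)).2.2.2,
      (h x (idealMul_le_right _ _ hx)).2.2.2]

end BalancedPair

/-- The Martindale symmetric ring of quotients `Q_s(R)` of a prime ring `R`. -/
def SymmQuotient (R : Type*) [NonUnitalRing R] [IsPrimeRing R] : Type _ :=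
  Quotient (BalancedPair.setoid R)

namespace SymmQuotient

open BalancedPair

variable {R : Type*} [NonUnitalRing R] [IsPrimeRing R]

/-- The class of a balanced pair. -/
def mk (q : BalancedPair R) : SymmQuotient R := Quotient.mk _ q

theorem mk_eq {q p : BalancedPair R}
    (h : ∀ x ∈ q.dom, x ∈ p.dom → q.left x = p.left x ∧ q.right x = p.right x) :
    mk q = mk p :=
  Quotient.sound (rel_of_eqOn h)

instance : Zero (SymmQuotient R) := ⟨mk (of 0)⟩
instance : One (SymmQuotient R) := ⟨mk one⟩
instance : Neg (SymmQuotient R) := ⟨Quotient.map neg fun _ _ h => rel_neg h⟩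
instance : Add (SymmQuotient R) := ⟨Quotient.map₂ add fun _ _ h _ _ h' => rel_add h h'⟩
instance : Mul (SymmQuotient R) := ⟨Quotient.map₂ mul fun _ _ h _ _ h' => rel_mul h h'⟩

instance : Ring (SymmQuotient R) where
  add_assoc := by
    rintro ⟨a⟩ ⟨b⟩ ⟨c⟩
    exact mk_eq (q := add (add a b) c) (p := add a (add b c))
      fun x _ _ => ⟨add_assoc _ _ _, add_assoc _ _ _⟩
  zero_add := by
    rintro ⟨a⟩
    refine mk_eq (q := add (of 0) a) (p := a) fun x _ _ => ⟨?_, ?_⟩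
    · change 0 * x + a.left x = a.left x
      rw [zero_mul, zero_add]
    · change x * 0 + a.right x = a.right x
      rw [mul_zero, zero_add]
  add_zero := by
    rintro ⟨a⟩
    refine mk_eq (q := add a (of 0)) (p := a) fun x _ _ => ⟨?_, ?_⟩
    · change a.left x + 0 * x = a.left x
      rw [zero_mul, add_zero]
    · change a.right x + x * 0 = a.right x
      rw [mul_zero, add_zero]
  add_comm := by
    rintro ⟨a⟩ ⟨b⟩
    exact mk_eq (q := add a b) (p := add b a) fun x _ _ => ⟨add_comm _ _, add_comm _ _⟩
  neg_add_cancel := by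
    rintro ⟨a⟩
    refine mk_eq (q := add (neg a) a) (p := of 0) fun x _ _ => ⟨?_, ?_⟩
    · change -a.left x + a.left x = 0 * x
      rw [zero_mul, neg_add_cancel]
    · change -a.right x + a.right x = x * 0
      rw [mul_zero, neg_add_cancel]
  mul_assoc := by
    rintro ⟨a⟩ ⟨b⟩ ⟨c⟩
    exact mk_eq (q := mul (mul a b) c) (p := mul a (mul b c)) fun x _ _ => ⟨rfl, rfl⟩
  one_mul := by
    rintro ⟨a⟩
    exact mk_eq (q := mul one a) (p := a) fun x _ _ => ⟨rfl, rfl⟩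
  mul_one := by
    rintro ⟨a⟩
    exact mk_eq (q := mul a one) (p := a) fun x _ _ => ⟨rfl, rfl⟩
  zero_mul := by
    rintro ⟨a⟩
    refine mk_eq (q := mul (of 0) a) (p := of 0) fun x _ _ => ⟨?_, ?_⟩
    · change 0 * a.left x = 0 * x
      rw [zero_mul, zero_mul]
    · change a.right (x * 0) = x * 0
      rw [mul_zero, right_zero]
  mul_zero := by
    rintro ⟨a⟩
    refine mk_eq (q := mul a (of 0)) (p := of 0) fun x _ _ => ⟨?_, ?_⟩
    · change a.left (0 * x) = 0 * x
      rw [zero_mul, left_zero]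
    · change a.right x * 0 = x * 0
      rw [mul_zero, mul_zero]
  left_distrib := by
    rintro ⟨a⟩ ⟨b⟩ ⟨c⟩
    refine mk_eq (q := mul a (add b c)) (p := add (mul a b) (mul a c)) fun x _ hx => ⟨?_, rfl⟩
    have hx := (TwoSidedIdeal.mem_inf R).1 hx
    exact a.left_add _ (b.left_mem (fun _ h => h) hx.1) _ (c.left_mem (fun _ h => h) hx.2)
  right_distrib := by
    rintro ⟨a⟩ ⟨b⟩ ⟨c⟩
    refine mk_eq (q := mul (add a b) c) (p := add (mul a c) (mul b c)) fun x _ hx => ⟨rfl, ?_⟩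
    have hx := (TwoSidedIdeal.mem_inf R).1 hx
    exact c.right_add _ (a.right_mem (fun _ h => h) hx.1) _ (b.right_mem (fun _ h => h) hx.2)
  nsmul := nsmulRec
  zsmul := zsmulRec

/-- The embedding of `R` into `Q_s(R)`. -/
def ofRing (R : Type*) [NonUnitalRing R] [IsPrimeRing R] : R →ₙ+* SymmQuotient R where
  toFun a := mk (of a)
  map_zero' := rfl
  map_add' a b := mk_eq (q := of (a + b)) (p := add (of a) (of b))
    fun _ _ _ => ⟨add_mul _ _ _, mul_add _ _ _⟩
  map_mul' a b := mk_eq (q := of (a * b)) (p := mul (of a) (of b))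
    fun _ _ _ => ⟨mul_assoc _ _ _, (mul_assoc _ _ _).symm⟩

theorem ofRing_injective : Function.Injective (ofRing R) := by
  intro a b hab
  obtain ⟨K, hK, h⟩ := Quotient.exact hab
  obtain ⟨y, hy, hy0⟩ := exists_ne_zero hK
  rcases IsPrimeRing.eq_zero_or_eq_zero (a - b) y (fun r => by
    have h1 : a * (r * y) = b * (r * y) := (h _ (K.mul_mem_left r y hy)).2.2.1
    rw [mul_assoc, sub_mul, h1, sub_self]) with h0 | h0
  · exact sub_eq_zero.1 h0
  · exact absurd h0 hy0

end SymmQuotient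

end Martindale

/-- The extended centroid `C` of a prime ring `R`: the center of `Q_s(R)`. -/
def extendedCentroid (R : Type*) [NonUnitalRing R] [IsPrimeRing R] :
    Subring (Martindale.SymmQuotient R) :=
  Subring.center (Martindale.SymmQuotient R)

/-- `A C`, the additive subgroup of `Q_s(R)` generated by all products `a c` with `a ∈ A`,
`c ∈ C`. -/
def mulCentroid {R : Type*} [NonUnitalRing R] [IsPrimeRing R] (A : AddSubgroup R) :
    AddSubgroup (Martindale.SymmQuotient R) :=
  A.map (Martindale.SymmQuotient.ofRing R : R →+ Martindale.SymmQuotient R) * (extendedCentroid R).toAddSubgroup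

/-- The subset `C a + C` of `Q_s(R)`. -/
def centroidLine {R : Type*} [NonUnitalRing R] [IsPrimeRing R] (a : R) :
    Set (Martindale.SymmQuotient R) :=
  {x | ∃ c ∈ extendedCentroid R, ∃ d ∈ extendedCentroid R, x = c * Martindale.SymmQuotient.ofRing R a + d}

/-- An additive subgroup `L` of `R` is a *Lie ideal* if `[L, R] ⊆ L`. -/
def IsLieIdeal {R : Type*} [NonUnitalRing R] (L : AddSubgroup R) : Prop :=
  ∀ x ∈ L, ∀ r : R, x * r - r * x ∈ L

/-- `L` is *noncentral* if it is not contained in the center of `R`. -/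
def IsNoncentral {R : Type*} [NonUnitalRing R] (L : AddSubgroup R) : Prop :=
  ¬ (L : Set R) ⊆ NonUnitalSubring.center R

/-- `[A, B]`, the additive subgroup of `R` generated by all `a b - b a`, `a ∈ A`, `b ∈ B`. -/
def addCommutatorSubgroup {R : Type*} [NonUnitalRing R] (A B : AddSubgroup R) : AddSubgroup R :=
  AddSubgroup.closure {x | ∃ a ∈ A, ∃ b ∈ B, x = a * b - b * a}

/-- The product `A₀ A₁ ⋯ Aₘ` of `m + 1` additive subgroups, where the product of two is the
additive subgroup generated by all products of elements. -/
def prodSubgroups {R : Type*} [NonUnitalRing R] :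
    (m : ℕ) → (Fin (m + 1) → AddSubgroup R) → AddSubgroup R
  | 0, A => A 0
  | m + 1, A => prodSubgroups m (fun i => A i.castSucc) * A (Fin.last (m + 1))

/-!
An element `t` that commutes with a product `K L` of nonzero Lie ideals commutes with `K` and
with `L`. For instance, `x (r t) - r t x` and `x r - r x` lie in `K` for every `x ∈ K`, so `t`
commutes with `x r [t, y]` for all `r`; primeness then forces `[t, y] = 0`. Hence the products
commute if and only if each `K_j` commutes elementwise with each `L_k`.

If `K` and `L` are commuting Lie ideals and `a ∈ K`, `b ∈ L` are noncentral, then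
`[a, [b, R]] = 0`. Expanding `[a, [b, r u s]]` gives `[a, r] u [b, s] = -[b, r] u [a, s]`, so by
Martindale's lemma `[b, r] = e [a, r]` for one `e ∈ C`, that is, `b ∈ C a + C`. The sum is
attained: the noncentral `a` has some `[a, r] ∉ C a`, and exchanging `1` for this element of `K`
shows `1 ∈ K C`. Conversely, `C a + C` is commutative.
-/

namespace IsPrimeRing

variable {R : Type*} [NonUnitalRing R] [IsPrimeRing R]

theorem eq_of_forall_mul_mul_eq {a b d : R} (hd : d ≠ 0) (h : ∀ r, a * r * d = b * r * d) :
    a = b :=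
  sub_eq_zero.1 <| (eq_zero_or_eq_zero (a - b) d fun r => by
    rw [sub_mul, sub_mul, h r, sub_self]).resolve_right hd

end IsPrimeRing

namespace Martindale.SymmQuotient

variable {R : Type*} [NonUnitalRing R] [IsPrimeRing R]

theorem mk_mul_ofRing (q : BalancedPair R) {x : R} (hx : x ∈ q.dom) :
    mk q * ofRing R x = ofRing R (q.left x) :=
  mk_eq (q := .mul q (.of x)) (p := .of (q.left x)) fun z hz _ =>
    ⟨q.left_mul x hx z, q.balanced z (idealMul_le_right _ _ hz) x hx⟩

theorem exists_ideal_mul_ofRing (q : SymmQuotient R) :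
    ∃ I : TwoSidedIdeal R, I ≠ ⊥ ∧ ∀ x ∈ I, ∃ y, q * ofRing R x = ofRing R y := by
  obtain ⟨q⟩ := q
  exact ⟨q.dom, q.dom_ne_bot, fun x hx => ⟨q.left x, mk_mul_ofRing q hx⟩⟩

theorem eq_zero_of_forall_mul_ofRing {q : SymmQuotient R} {I : TwoSidedIdeal R} (hI : I ≠ ⊥)
    (h : ∀ x ∈ I, q * ofRing R x = 0) : q = 0 := by
  obtain ⟨q⟩ := q
  have hJ := inf_ne_bot hI q.dom_ne_bot
  have mem_dom : ∀ x ∈ I ⊓ q.dom, x ∈ q.dom := fun x hx => ((TwoSidedIdeal.mem_inf R).1 hx).2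
  have left_eq_zero : ∀ x ∈ I ⊓ q.dom, q.left x = 0 := fun x hx => ofRing_injective <| by
    rw [map_zero, ← h x ((TwoSidedIdeal.mem_inf R).1 hx).1]
    exact (mk_mul_ofRing q (mem_dom x hx)).symm
  have right_eq_zero : ∀ x ∈ I ⊓ q.dom, q.right x = 0 := fun x hx => by
    obtain ⟨y, hy, hy0⟩ := exists_ne_zero hJ
    refine IsPrimeRing.eq_of_forall_mul_mul_eq hy0 fun r => ?_
    have hry := TwoSidedIdeal.mul_mem_left _ r y hy
    rw [mul_assoc, q.balanced x (mem_dom x hx) _ (mem_dom _ hry), left_eq_zero _ hry, mul_zero,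
      zero_mul, zero_mul]
  exact Quotient.sound ⟨I ⊓ q.dom, hJ, fun x hx => ⟨mem_dom x hx, TwoSidedIdeal.mem_top R,
    (left_eq_zero x hx).trans (zero_mul x).symm, (right_eq_zero x hx).trans (mul_zero x).symm⟩⟩

theorem eq_zero_or_eq_zero_of_forall_mul_ofRing_mul {p q : SymmQuotient R}
    (h : ∀ r, p * ofRing R r * q = 0) : p = 0 ∨ q = 0 := by
  refine or_iff_not_imp_left.2 fun hp0 => ?_
  obtain ⟨I, hI, hp⟩ := exists_ideal_mul_ofRing p
  obtain ⟨J, hJ, hq⟩ := exists_ideal_mul_ofRing q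
  obtain ⟨x, hx, hpx⟩ : ∃ x ∈ I, p * ofRing R x ≠ 0 := by
    by_contra! hpI
    exact hp0 (eq_zero_of_forall_mul_ofRing hI hpI)
  refine eq_zero_of_forall_mul_ofRing hJ fun y hy => ?_
  obtain ⟨x', hx'⟩ := hp x hx
  obtain ⟨y', hy'⟩ := hq y hy
  have hzero : x' = 0 ∨ y' = 0 := IsPrimeRing.eq_zero_or_eq_zero _ _ fun r => ofRing_injective <|
    calc ofRing R (x' * r * y')
        = p * ofRing R (x * r) * q * ofRing R y := by
          simp only [map_mul, ← hx', ← hy', mul_assoc]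
      _ = ofRing R 0 := by rw [h, zero_mul, map_zero]
  rcases hzero with rfl | rfl
  · exact absurd (hx'.trans (map_zero _)) hpx
  · exact hy'.trans (map_zero _)

theorem ofRing_lie (a b : R) : ofRing R ⁅a, b⁆ = ⁅ofRing R a, ofRing R b⁆ := by
  simp only [Ring.lie_def, map_sub, map_mul]

end Martindale.SymmQuotient

open Martindale SymmQuotient Submodule

namespace extendedCentroid

variable {R : Type*} [NonUnitalRing R] [IsPrimeRing R]

theorem mem_iff_forall_commute_ofRing {q : SymmQuotient R} :
    q ∈ extendedCentroid R ↔ ∀ r, Commute q (ofRing R r) := by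
  refine ⟨fun hq r => (Subring.mem_center_iff.1 hq _).symm,
    fun h => Subring.mem_center_iff.2 fun p => ?_⟩
  obtain ⟨I, hI, hp⟩ := exists_ideal_mul_ofRing p
  refine sub_eq_zero.1 (eq_zero_of_forall_mul_ofRing hI fun x hx => ?_)
  obtain ⟨y, hy⟩ := hp x hx
  rw [sub_mul, mul_assoc, mul_assoc, hy, h x, h y, ← mul_assoc, hy, sub_self]

theorem ofRing_mem_iff {a : R} :
    ofRing R a ∈ extendedCentroid R ↔ a ∈ NonUnitalSubring.center R := by
  simp only [mem_iff_forall_commute_ofRing, NonUnitalSubring.mem_center_iff, Commute, SemiconjBy,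
    ← map_mul, ofRing_injective.eq_iff, eq_comm]

instance : CommRing (extendedCentroid R) :=
  inferInstanceAs (CommRing (Subring.center (SymmQuotient R)))

instance : Algebra (extendedCentroid R) (SymmQuotient R) :=
  inferInstanceAs (Algebra (Subring.center (SymmQuotient R)) (SymmQuotient R))

theorem exists_smul_eq_of_bimoduleHom {I : TwoSidedIdeal R} (hI : I ≠ ⊥) (f : R → R)
    (map_add : ∀ x ∈ I, ∀ y ∈ I, f (x + y) = f x + f y)
    (map_mul_right : ∀ x ∈ I, ∀ r, f (x * r) = f x * r)
    (map_mul_left : ∀ x ∈ I, ∀ r, f (r * x) = r * f x) :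
    ∃ e : extendedCentroid R, ∀ x ∈ I, e • ofRing R x = ofRing R (f x) := by
  let q : BalancedPair R :=
    { dom := I
      dom_ne_bot := hI
      left := f
      right := f
      left_add := map_add
      right_add := map_add
      left_mul := map_mul_right
      right_mul := map_mul_left
      balanced := fun x hx y hy => by rw [← map_mul_right x hx, map_mul_left y hy] }
  have hq : ∀ x ∈ I, mk q * ofRing R x = ofRing R (f x) := fun x => mk_mul_ofRing q
  refine ⟨⟨mk q, mem_iff_forall_commute_ofRing.2 fun r => sub_eq_zero.1 <|
    eq_zero_of_forall_mul_ofRing hI fun x hx => ?_⟩, hq⟩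
  rw [sub_mul, mul_assoc, mul_assoc, hq x hx, ← map_mul, ← map_mul,
    hq _ (I.mul_mem_left r x hx), map_mul_left x hx, sub_self]

/-- The ideal of all `x` that admit a `y` with `x u b = y u d` for all `u`: the domain of
definition of the bimodule homomorphism `x ↦ y` in Martindale's lemma. -/
def ratioIdeal {R : Type*} [NonUnitalRing R] (b d : R) : TwoSidedIdeal R :=
  TwoSidedIdeal.mk' {x : R | ∃ y, ∀ u, x * u * b = y * u * d}
    ⟨0, fun u => by simp only [zero_mul]⟩
    (fun ⟨y, hy⟩ ⟨y', hy'⟩ => ⟨y + y', fun u => by simp only [add_mul, hy u, hy' u]⟩)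
    (fun ⟨y, hy⟩ => ⟨-y, fun u => by simp only [neg_mul, hy u]⟩)
    (fun {r _} ⟨y, hy⟩ => ⟨r * y, fun u => by simpa only [mul_assoc] using congrArg (r * ·) (hy u)⟩)
    (fun {_ r} ⟨y, hy⟩ => ⟨y * r, fun u => by simpa only [mul_assoc] using hy (r * u)⟩)

theorem mem_ratioIdeal {R : Type*} [NonUnitalRing R] {b d x : R} :
    x ∈ ratioIdeal b d ↔ ∃ y, ∀ u, x * u * b = y * u * d := by
  rw [ratioIdeal, TwoSidedIdeal.mem_mk']
  rfl

theorem exists_smul_eq_of_mem_ratioIdeal {b d : R} (hd : d ≠ 0) (hI : ratioIdeal b d ≠ ⊥) :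
    ∃ e : extendedCentroid R, ∀ x y : R, (∀ u, x * u * b = y * u * d) →
      e • ofRing R x = ofRing R y := by
  choose! f hf using fun x (hx : x ∈ ratioIdeal b d) => mem_ratioIdeal.1 hx
  have f_eq : ∀ {x y}, (∀ u, x * u * b = y * u * d) → f x = y := fun {x y} h =>
    IsPrimeRing.eq_of_forall_mul_mul_eq hd fun u => by rw [← hf x (mem_ratioIdeal.2 ⟨y, h⟩), h]
  obtain ⟨e, he⟩ := exists_smul_eq_of_bimoduleHom hI f
    (fun x hx y hy => f_eq fun u => by simp only [add_mul, hf x hx u, hf y hy u])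
    (fun x hx r => f_eq fun u => by simpa only [mul_assoc] using hf x hx (r * u))
    (fun x hx r => f_eq fun u => by simpa only [mul_assoc] using congrArg (r * ·) (hf x hx u))
  exact ⟨e, fun x y h => f_eq h ▸ he x (mem_ratioIdeal.2 ⟨y, h⟩)⟩

/-- **Martindale's lemma**. -/
theorem exists_smul_eq_of_forall_mul_mul_eq {a b c d : R} (ha : a ≠ 0) (hd : d ≠ 0)
    (h : ∀ u, a * u * b = c * u * d) :
    ∃ e : extendedCentroid R,
      e • ofRing R a = ofRing R c ∧ e • ofRing R d = ofRing R b := by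
  have hI : ratioIdeal b d ≠ ⊥ := fun hI =>
    ha ((TwoSidedIdeal.mem_bot R).1 (hI ▸ mem_ratioIdeal.2 ⟨c, h⟩))
  obtain ⟨e, he⟩ := exists_smul_eq_of_mem_ratioIdeal hd hI
  refine ⟨e, he a c h, sub_eq_zero.1 <| (eq_zero_or_eq_zero_of_forall_mul_ofRing_mul fun u => ?_
    ).resolve_left ((map_ne_zero_iff _ ofRing_injective).2 ha)⟩
  rw [mul_sub, mul_smul_comm, ← smul_mul_assoc, ← smul_mul_assoc, he a c h, ← map_mul, ← map_mul,
    ← map_mul, ← map_mul, h u, sub_self]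

theorem exists_mul_eq_one {c : extendedCentroid R} (hc : c ≠ 0) :
    ∃ e : extendedCentroid R, c * e = 1 := by
  obtain ⟨I, hI, hcI⟩ := exists_ideal_mul_ofRing (c : SymmQuotient R)
  obtain ⟨x, hx, hcx⟩ : ∃ x ∈ I, c • ofRing R x ≠ 0 := by
    by_contra! h
    exact hc (Subtype.ext (eq_zero_of_forall_mul_ofRing hI h))
  obtain ⟨y, hy⟩ : ∃ y, c • ofRing R x = ofRing R y := hcI x hx
  have hy0 : y ≠ 0 := by
    rintro rfl
    exact hcx (hy.trans (map_zero _))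
  obtain ⟨e, he, -⟩ := exists_smul_eq_of_forall_mul_mul_eq hy0 hy0 (b := x) (c := x) fun u =>
    ofRing_injective <| by
      simp only [map_mul, ← hy, smul_mul_assoc, mul_smul_comm]
  have hcex : (c * e - 1) • ofRing R y = 0 := by
    rw [sub_smul, one_smul, mul_smul, he, hy, sub_self]
  refine ⟨e, sub_eq_zero.1 <| Subtype.ext <| (eq_zero_or_eq_zero_of_forall_mul_ofRing_mul
    fun r => ?_).resolve_right ((map_ne_zero_iff _ ofRing_injective).2 hy0)⟩
  change (c * e - 1) • ofRing R r * ofRing R y = 0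
  rw [smul_mul_assoc, ← mul_smul_comm, hcex, mul_zero]

noncomputable instance : Field (extendedCentroid R) :=
  have : Nontrivial (SymmQuotient R) := ofRing_injective.nontrivial
  IsField.toField ⟨exists_pair_ne _, mul_comm, exists_mul_eq_one⟩

theorem ofRing_mem_span_one_iff {a : R} :
    ofRing R a ∈ span (extendedCentroid R) {1} ↔ a ∈ NonUnitalSubring.center R := by
  rw [← ofRing_mem_iff, ← one_eq_span, mem_one]
  exact ⟨fun ⟨c, hc⟩ => hc ▸ c.2, fun ha => ⟨⟨_, ha⟩, rfl⟩⟩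

end extendedCentroid

section Commutators

variable {R : Type*} [NonUnitalRing R]

theorem addCommutatorSubgroup_eq_bot_iff {A B : AddSubgroup R} :
    addCommutatorSubgroup A B = ⊥ ↔ ∀ a ∈ A, ∀ b ∈ B, Commute a b := by
  rw [addCommutatorSubgroup, AddSubgroup.closure_eq_bot_iff]
  constructor
  · intro h a ha b hb
    exact commute_iff_lie_eq.2 (h ⟨a, ha, b, hb, rfl⟩)
  · rintro h _ ⟨a, ha, b, hb, rfl⟩
    exact commute_iff_lie_eq.1 (h a ha b hb)

theorem exists_lie_ne_zero {a : R} (ha : a ∉ NonUnitalSubring.center R) : ∃ r : R, ⁅a, r⁆ ≠ 0 := by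
  by_contra! h
  exact ha (NonUnitalSubring.mem_center_iff.2 fun r => (commute_iff_lie_eq.2 (h r)).eq.symm)

theorem lie_mul_lie_add_eq_zero {a b : R} (h : ∀ r : R, Commute a ⁅b, r⁆) (r s : R) :
    ⁅a, r⁆ * ⁅b, s⁆ + ⁅b, r⁆ * ⁅a, s⁆ = 0 :=
  calc ⁅a, r⁆ * ⁅b, s⁆ + ⁅b, r⁆ * ⁅a, s⁆
      = ⁅a, ⁅b, r * s⁆⁆ - ⁅a, ⁅b, r⁆⁆ * s - r * ⁅a, ⁅b, s⁆⁆ := by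
        simp only [Ring.lie_def]
        noncomm_ring
    _ = 0 := by simp only [(h _).lie_eq, zero_mul, mul_zero, sub_zero]

theorem lie_mul_mul_lie_eq_neg {a b : R} (h : ∀ r : R, Commute a ⁅b, r⁆) (r u s : R) :
    ⁅a, r⁆ * u * ⁅b, s⁆ = -⁅b, r⁆ * u * ⁅a, s⁆ := by
  refine sub_eq_zero.1 ?_
  calc ⁅a, r⁆ * u * ⁅b, s⁆ - -⁅b, r⁆ * u * ⁅a, s⁆
      = (⁅a, r⁆ * ⁅b, u * s⁆ + ⁅b, r⁆ * ⁅a, u * s⁆)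
          - (⁅a, r⁆ * ⁅b, u⁆ + ⁅b, r⁆ * ⁅a, u⁆) * s := by
        simp only [Ring.lie_def]
        noncomm_ring
    _ = 0 := by simp only [lie_mul_lie_add_eq_zero h, zero_mul, sub_zero]

variable [IsPrimeRing R]

theorem ofRing_mem_span_pair_of_forall_commute_lie {a b : R}
    (ha : a ∉ NonUnitalSubring.center R) (h : ∀ r : R, Commute a ⁅b, r⁆) :
    ofRing R b ∈ span (extendedCentroid R) {ofRing R a, 1} := by
  obtain ⟨t, ht⟩ := exists_lie_ne_zero ha
  obtain ⟨c, -, hc⟩ := extendedCentroid.exists_smul_eq_of_forall_mul_mul_eq ht ht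
    fun u => lie_mul_mul_lie_eq_neg h t u t
  have lie_eq_zero (r : R) : ⁅c • ofRing R a + ofRing R b, ofRing R r⁆ = 0 := by
    have lie_eq : ⁅c • ofRing R a + ofRing R b, ofRing R r⁆
        = c • ofRing R ⁅a, r⁆ + ofRing R ⁅b, r⁆ := by
      rw [ofRing_lie, ofRing_lie]
      simp only [Ring.lie_def, add_mul, mul_add, smul_mul_assoc, mul_smul_comm, smul_sub]
      abel
    rw [lie_eq]
    refine (eq_zero_or_eq_zero_of_forall_mul_ofRing_mul fun u => ?_).resolve_right
      ((map_ne_zero_iff _ ofRing_injective).2 ht)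
    calc (c • ofRing R ⁅a, r⁆ + ofRing R ⁅b, r⁆) * ofRing R u * ofRing R ⁅a, t⁆
        = ofRing R ⁅a, r⁆ * ofRing R u * (c • ofRing R ⁅a, t⁆)
            + ofRing R ⁅b, r⁆ * ofRing R u * ofRing R ⁅a, t⁆ := by
          simp only [add_mul, smul_mul_assoc, mul_smul_comm]
      _ = ofRing R (⁅a, r⁆ * u * ⁅b, t⁆ + ⁅b, r⁆ * u * ⁅a, t⁆) := by
          rw [hc, map_add, map_mul, map_mul, map_mul, map_mul]
      _ = 0 := by
          rw [lie_mul_mul_lie_eq_neg h, neg_mul, neg_mul, neg_add_cancel, map_zero]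
  have hd : c • ofRing R a + ofRing R b ∈ extendedCentroid R :=
    extendedCentroid.mem_iff_forall_commute_ofRing.2 fun r => commute_iff_lie_eq.2 (lie_eq_zero r)
  refine mem_span_pair.2 ⟨-c, ⟨_, hd⟩, ?_⟩
  change -c • ofRing R a + (c • ofRing R a + ofRing R b) * 1 = ofRing R b
  rw [neg_smul, mul_one, neg_add_cancel_left]

theorem exists_ofRing_lie_notMem_span_singleton {a : R} (ha : a ∉ NonUnitalSubring.center R) :
    ∃ r : R, ofRing R ⁅a, r⁆ ∉ span (extendedCentroid R) {ofRing R a} := by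
  by_contra! h
  choose l hl using fun r => mem_span_singleton.1 (h r)
  obtain ⟨t, ht⟩ := exists_lie_ne_zero ha
  have hlt : l t ≠ 0 := fun h0 => ht (ofRing_injective (by rw [← hl t, h0, zero_smul, map_zero]))
  obtain ⟨μ, hμ⟩ : ∃ μ : extendedCentroid R, μ • ofRing R a = ofRing R a * ofRing R a := by
    have lie_mul : ⁅a, t * a⁆ = ⁅a, t⁆ * a := by
      simp only [Ring.lie_def, sub_mul, mul_assoc]
    refine mem_span_singleton.1 ((smul_mem_iff _ hlt).1 ?_)
    rw [← smul_mul_assoc, hl, ← map_mul, ← lie_mul]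
    exact h _
  have mul_eq (s : R) :
      ofRing R s * ofRing R a = ofRing R a * ofRing R s - l s • ofRing R a := by
    rw [hl, ofRing_lie, Ring.lie_def, sub_sub_cancel]
  have hzero (s : R) : (ofRing R a - μ • 1) * ofRing R s * ofRing R a = 0 :=
    calc (ofRing R a - μ • 1) * ofRing R s * ofRing R a
        = ofRing R a * (ofRing R s * ofRing R a) - μ • (ofRing R s * ofRing R a) := by
          rw [sub_mul, sub_mul, smul_mul_assoc, one_mul, smul_mul_assoc, mul_assoc]
      _ = 0 := by
          rw [mul_eq, mul_sub, mul_smul_comm, ← mul_assoc, ← hμ, smul_mul_assoc, smul_sub,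
            smul_comm, sub_self]
  have ha0 : ofRing R a ≠ 0 := by
    rw [map_ne_zero_iff _ ofRing_injective]
    rintro rfl
    exact ha (zero_mem _)
  have ha_eq : ofRing R a = μ • 1 :=
    sub_eq_zero.1 ((eq_zero_or_eq_zero_of_forall_mul_ofRing_mul hzero).resolve_right ha0)
  exact ha (extendedCentroid.ofRing_mem_span_one_iff.1 (mem_span_singleton.2 ⟨μ, ha_eq.symm⟩))

theorem span_pair_one_eq_of_mem {a b : R}
    (hb : ofRing R b ∈ span (extendedCentroid R) {ofRing R a, 1})
    (hb_nc : b ∉ NonUnitalSubring.center R) :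
    span (extendedCentroid R) {ofRing R b, 1} = span (extendedCentroid R) {ofRing R a, 1} := by
  have ha := mem_span_insert_exchange hb (mt extendedCentroid.ofRing_mem_span_one_iff.1 hb_nc)
  refine le_antisymm (span_le.2 ?_) (span_le.2 ?_) <;> rw [Set.pair_subset_iff]
  · exact ⟨hb, subset_span (Set.mem_insert_of_mem _ rfl)⟩
  · exact ⟨ha, subset_span (Set.mem_insert_of_mem _ rfl)⟩

theorem commute_of_ofRing_mem_span_pair_one {x y : R} {q : SymmQuotient R}
    (hx : ofRing R x ∈ span (extendedCentroid R) {q, 1})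
    (hy : ofRing R y ∈ span (extendedCentroid R) {q, 1}) : Commute x y := by
  have span_le_adjoin : span (extendedCentroid R) {q, 1}
      ≤ Subalgebra.toSubmodule (Algebra.adjoin (extendedCentroid R) {q}) :=
    span_le.2 (Set.pair_subset (Algebra.self_mem_adjoin_singleton _ q)
      (Subalgebra.one_mem _))
  refine ofRing_injective ?_
  rw [map_mul, map_mul]
  exact Algebra.commute_of_mem_adjoin_of_forall_mem_commute (span_le_adjoin hy) <| by
    simpa using (Algebra.commute_of_mem_adjoin_self (span_le_adjoin hx)).symm

end Commutators

section LieIdeals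

variable {R : Type*} [NonUnitalRing R] {K L : AddSubgroup R}

theorem IsNoncentral.exists_notMem (hK : IsNoncentral K) :
    ∃ a ∈ K, a ∉ NonUnitalSubring.center R :=
  Set.not_subset.1 hK

theorem IsNoncentral.ne_bot (hK : IsNoncentral K) : K ≠ ⊥ := by
  rintro rfl
  obtain ⟨a, ha, ha_nc⟩ := hK.exists_notMem
  exact ha_nc (AddSubgroup.mem_bot.1 ha ▸ zero_mem _)

theorem IsLieIdeal.mul (hK : IsLieIdeal K) (hL : IsLieIdeal L) : IsLieIdeal (K * L) := by
  intro z hz r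
  refine AddSubmonoid.mul_induction_on hz (fun x hx y hy => ?_) fun z z' hz hz' => ?_
  · have leibniz : x * y * r - r * (x * y) = (x * r - r * x) * y + x * (y * r - r * y) := by
      noncomm_ring
    rw [leibniz]
    exact add_mem (AddSubmonoid.mul_mem_mul (hK x hx r) hy)
      (AddSubmonoid.mul_mem_mul hx (hL y hy r))
  · rw [add_mul, mul_add, add_sub_add_comm]
    exact add_mem hz hz'

theorem isLieIdeal_prodSubgroups {m : ℕ} {K : Fin (m + 1) → AddSubgroup R}
    (hK : ∀ j, IsLieIdeal (K j)) : IsLieIdeal (prodSubgroups m K) := by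
  induction m with
  | zero => exact hK 0
  | succ m ih => exact (ih fun j => hK j.castSucc).mul (hK _)

variable [IsPrimeRing R]

theorem IsLieIdeal.left_eq_zero_of_forall_mul_eq_zero (hL : IsLieIdeal L) (hL0 : L ≠ ⊥) {x : R}
    (h : ∀ y ∈ L, x * y = 0) : x = 0 := by
  obtain ⟨y, hy, hy0⟩ := (AddSubgroup.bot_or_exists_ne_zero L).resolve_left hL0
  refine (IsPrimeRing.eq_zero_or_eq_zero x y fun r => ?_).resolve_right hy0
  simpa only [mul_sub, ← mul_assoc, h y hy, zero_mul, zero_sub, neg_eq_zero] using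
    h _ (hL y hy r)

theorem IsLieIdeal.right_eq_zero_of_forall_mul_eq_zero (hK : IsLieIdeal K) (hK0 : K ≠ ⊥) {y : R}
    (h : ∀ x ∈ K, x * y = 0) : y = 0 := by
  obtain ⟨x, hx, hx0⟩ := (AddSubgroup.bot_or_exists_ne_zero K).resolve_left hK0
  refine (IsPrimeRing.eq_zero_or_eq_zero x y fun r => ?_).resolve_left hx0
  simpa only [sub_mul, mul_assoc, h x hx, mul_zero, sub_zero] using h _ (hK x hx r)

theorem IsLieIdeal.mul_ne_bot (hL : IsLieIdeal L) (hK0 : K ≠ ⊥) (hL0 : L ≠ ⊥) : K * L ≠ ⊥ := by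
  obtain ⟨x, hx, hx0⟩ := (AddSubgroup.bot_or_exists_ne_zero K).resolve_left hK0
  exact fun h => hx0 <| hL.left_eq_zero_of_forall_mul_eq_zero hL0 fun y hy =>
    (AddSubgroup.eq_bot_iff_forall _).1 h _ (AddSubmonoid.mul_mem_mul hx hy)

theorem IsLieIdeal.commute_right_of_forall_commute_mul (hK : IsLieIdeal K) (hK0 : K ≠ ⊥)
    {t y : R} (h : ∀ x ∈ K, Commute t (x * y)) : Commute t y := by
  have commute_mul_lie {x : R} (hx : x ∈ K) (r : R) : Commute t (x * r * ⁅t, y⁆) := by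
    have expand : x * r * ⁅t, y⁆
        = (x * (r * t) - r * t * x) * y - (x * r - r * x) * y * t + r * ⁅t, x * y⁆ := by
      simp only [Ring.lie_def]
      noncomm_ring
    rw [expand, (h x hx).lie_eq, mul_zero, add_zero]
    exact (h _ (hK x hx _)).sub_right ((h _ (hK x hx r)).mul_right (Commute.refl t))
  refine commute_iff_lie_eq.2 (by_contra fun hlie => hlie ?_)
  refine hK.left_eq_zero_of_forall_mul_eq_zero hK0 fun x hx =>
    (IsPrimeRing.eq_zero_or_eq_zero (⁅t, y⁆ * x) ⁅t, y⁆ fun r => ?_).resolve_right hlie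
  have commute_mul_mul_lie : Commute t (y * (x * r * ⁅t, y⁆)) := by
    have expand : y * (x * r * ⁅t, y⁆) = x * (y * r) * ⁅t, y⁆ - (x * y - y * x) * r * ⁅t, y⁆ := by
      noncomm_ring
    rw [expand]
    exact (commute_mul_lie hx _).sub_right (commute_mul_lie (hK x hx y) r)
  calc ⁅t, y⁆ * x * r * ⁅t, y⁆
      = ⁅t, y * (x * r * ⁅t, y⁆)⁆ - y * ⁅t, x * r * ⁅t, y⁆⁆ := by
        simp only [Ring.lie_def]
        noncomm_ring
    _ = 0 := by rw [commute_mul_mul_lie.lie_eq, (commute_mul_lie hx r).lie_eq, mul_zero, sub_zero]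

theorem IsLieIdeal.commute_left_of_forall_commute_mul (hL : IsLieIdeal L) (hL0 : L ≠ ⊥)
    {t x : R} (h : ∀ y ∈ L, Commute t (x * y)) : Commute t x := by
  have commute_lie_mul {y : R} (hy : y ∈ L) (r : R) : Commute t (⁅t, x⁆ * r * y) := by
    have expand : ⁅t, x⁆ * r * y
        = x * (y * (t * r) - t * r * y) - t * (x * (y * r - r * y)) + ⁅t, x * y⁆ * r := by
      simp only [Ring.lie_def]
      noncomm_ring
    rw [expand, (h y hy).lie_eq, zero_mul, add_zero]
    exact (h _ (hL y hy _)).sub_right ((Commute.refl t).mul_right (h _ (hL y hy r)))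
  refine commute_iff_lie_eq.2 (by_contra fun hlie => hlie ?_)
  refine hL.right_eq_zero_of_forall_mul_eq_zero hL0 fun y hy =>
    (IsPrimeRing.eq_zero_or_eq_zero ⁅t, x⁆ (y * ⁅t, x⁆) fun r => ?_).resolve_left hlie
  have commute_lie_mul_mul : Commute t (⁅t, x⁆ * r * y * x) := by
    have expand : ⁅t, x⁆ * r * y * x = ⁅t, x⁆ * (r * x) * y + ⁅t, x⁆ * r * (y * x - x * y) := by
      noncomm_ring
    rw [expand]
    exact (commute_lie_mul hy _).add_right (commute_lie_mul (hL y hy x) r)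
  calc ⁅t, x⁆ * r * (y * ⁅t, x⁆)
      = ⁅t, ⁅t, x⁆ * r * y * x⁆ - ⁅t, ⁅t, x⁆ * r * y⁆ * x := by
        simp only [Ring.lie_def]
        noncomm_ring
    _ = 0 := by rw [commute_lie_mul_mul.lie_eq, (commute_lie_mul hy r).lie_eq, zero_mul, sub_zero]

theorem IsLieIdeal.forall_mem_mul_commute_iff (hK : IsLieIdeal K) (hL : IsLieIdeal L)
    (hK0 : K ≠ ⊥) (hL0 : L ≠ ⊥) {t : R} :
    (∀ z ∈ K * L, Commute t z) ↔ (∀ x ∈ K, Commute t x) ∧ ∀ y ∈ L, Commute t y := by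
  refine ⟨fun h => ⟨fun x hx => ?_, fun y hy => ?_⟩, fun ⟨hKt, hLt⟩ z hz => ?_⟩
  · exact hL.commute_left_of_forall_commute_mul hL0 fun y hy =>
      h _ (AddSubmonoid.mul_mem_mul hx hy)
  · exact hK.commute_right_of_forall_commute_mul hK0 fun x hx =>
      h _ (AddSubmonoid.mul_mem_mul hx hy)
  · exact AddSubmonoid.mul_induction_on hz
      (fun x hx y hy => (hKt x hx).mul_right (hLt y hy)) fun _ _ => Commute.add_right

theorem prodSubgroups_ne_bot {m : ℕ} {K : Fin (m + 1) → AddSubgroup R}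
    (hK : ∀ j, IsLieIdeal (K j)) (hK0 : ∀ j, K j ≠ ⊥) : prodSubgroups m K ≠ ⊥ := by
  induction m with
  | zero => exact hK0 0
  | succ m ih =>
    exact (hK _).mul_ne_bot (ih (fun j => hK j.castSucc) fun j => hK0 j.castSucc) (hK0 _)

theorem forall_mem_prodSubgroups_commute_iff {m : ℕ} {K : Fin (m + 1) → AddSubgroup R}
    (hK : ∀ j, IsLieIdeal (K j)) (hK0 : ∀ j, K j ≠ ⊥) {t : R} :
    (∀ z ∈ prodSubgroups m K, Commute t z) ↔ ∀ j, ∀ x ∈ K j, Commute t x := by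
  induction m with
  | zero => exact (Fin.forall_fin_one (p := fun j => ∀ x ∈ K j, Commute t x)).symm
  | succ m ih =>
    have hK' : ∀ j : Fin (m + 1), IsLieIdeal (K j.castSucc) := fun j => hK _
    have hK0' : ∀ j : Fin (m + 1), K j.castSucc ≠ ⊥ := fun j => hK0 _
    rw [Fin.forall_fin_succ', ← ih hK' hK0']
    exact (isLieIdeal_prodSubgroups hK').forall_mem_mul_commute_iff (hK _)
      (prodSubgroups_ne_bot hK' hK0') (hK0 _)

theorem forall_mem_prodSubgroups_commute_prodSubgroups_iff {m n : ℕ}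
    {K : Fin (m + 1) → AddSubgroup R} {L : Fin (n + 1) → AddSubgroup R}
    (hK : ∀ j, IsLieIdeal (K j)) (hK0 : ∀ j, K j ≠ ⊥)
    (hL : ∀ k, IsLieIdeal (L k)) (hL0 : ∀ k, L k ≠ ⊥) :
    (∀ z ∈ prodSubgroups m K, ∀ w ∈ prodSubgroups n L, Commute z w) ↔
      ∀ j k, ∀ x ∈ K j, ∀ y ∈ L k, Commute x y := by
  simp only [forall_mem_prodSubgroups_commute_iff hL hL0]
  constructor
  · exact fun h j k x hx y hy => ((forall_mem_prodSubgroups_commute_iff hK hK0).1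
      (fun z hz => (h z hz k y hy).symm) j x hx).symm
  · exact fun h z hz k y hy => ((forall_mem_prodSubgroups_commute_iff hK hK0).2
      (fun j x hx => (h j k x hx y hy).symm) z hz).symm

end LieIdeals

section CentroidSpan

variable {R : Type*} [NonUnitalRing R] [IsPrimeRing R] {K L : AddSubgroup R} {a b : R}

theorem mulCentroid_eq_span (K : AddSubgroup R) :
    mulCentroid K = (span (extendedCentroid R) (ofRing R '' K)).toAddSubgroup := by
  have smul_eq_mul (c : extendedCentroid R) (x : R) : c • ofRing R x = ofRing R x * c :=
    Algebra.commutes c (ofRing R x)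
  refine le_antisymm (fun z hz => ?_) (fun z hz => ?_)
  · refine AddSubmonoid.mul_induction_on hz ?_ fun _ _ => add_mem
    rintro _ ⟨x, hx, rfl⟩ c hc
    exact smul_eq_mul ⟨c, hc⟩ x ▸ smul_mem _ _ (subset_span (Set.mem_image_of_mem _ hx))
  · refine closure_induction (p := fun z _ => z ∈ mulCentroid K) (zero_mem _)
      (fun _ _ _ _ => add_mem) ?_ hz
    rintro c _ ⟨x, hx, rfl⟩
    exact smul_eq_mul c x ▸ AddSubmonoid.mul_mem_mul (AddSubgroup.mem_map_of_mem _ hx) c.2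

theorem coe_centroidLine (a : R) :
    centroidLine a = (span (extendedCentroid R) {ofRing R a, 1} : Set (SymmQuotient R)) := by
  ext z
  rw [SetLike.mem_coe, mem_span_pair]
  constructor
  · rintro ⟨c, hc, d, hd, rfl⟩
    exact ⟨⟨c, hc⟩, ⟨d, hd⟩, congrArg (c * ofRing R a + ·) (mul_one d)⟩
  · rintro ⟨c, d, rfl⟩
    exact ⟨c, c.2, d, d.2, congrArg (c * ofRing R a + ·) (mul_one (d : SymmQuotient R))⟩

theorem IsLieIdeal.span_eq_span_pair_one (hK : IsLieIdeal K) (ha : a ∈ K)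
    (ha_nc : a ∉ NonUnitalSubring.center R)
    (h : ∀ x ∈ K, ofRing R x ∈ span (extendedCentroid R) {ofRing R a, 1}) :
    span (extendedCentroid R) (ofRing R '' K) = span (extendedCentroid R) {ofRing R a, 1} := by
  refine le_antisymm (span_le.2 (Set.image_subset_iff.2 h)) (span_le.2 (Set.pair_subset ?_ ?_))
  · exact subset_span (Set.mem_image_of_mem _ ha)
  · obtain ⟨r, hr⟩ := exists_ofRing_lie_notMem_span_singleton ha_nc
    have hlie : ⁅a, r⁆ ∈ K := hK a ha r
    have one_mem_span := mem_span_insert_exchange (Set.pair_comm _ _ ▸ h _ hlie) hr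
    exact span_mono (Set.pair_subset (Set.mem_image_of_mem _ hlie) (Set.mem_image_of_mem _ ha))
      one_mem_span

theorem IsLieIdeal.span_eq_span_pair_one_of_forall_commute (hK : IsLieIdeal K)
    (hL : IsLieIdeal L) (h : ∀ x ∈ K, ∀ y ∈ L, Commute x y)
    (ha : a ∈ K) (ha_nc : a ∉ NonUnitalSubring.center R)
    (hb : b ∈ L) (hb_nc : b ∉ NonUnitalSubring.center R) :
    span (extendedCentroid R) (ofRing R '' K) = span (extendedCentroid R) {ofRing R a, 1} ∧
      span (extendedCentroid R) (ofRing R '' L) = span (extendedCentroid R) {ofRing R a, 1} := by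
  have mem_of_mem_left : ∀ x ∈ K, ofRing R x ∈ span (extendedCentroid R) {ofRing R b, 1} :=
    fun x hx => ofRing_mem_span_pair_of_forall_commute_lie hb_nc fun r =>
      (h _ (hK x hx r) b hb).symm
  have mem_of_mem_right : ∀ y ∈ L, ofRing R y ∈ span (extendedCentroid R) {ofRing R a, 1} :=
    fun y hy => ofRing_mem_span_pair_of_forall_commute_lie ha_nc fun r => h a ha _ (hL y hy r)
  have pair_eq := span_pair_one_eq_of_mem (mem_of_mem_left a ha) ha_nc
  exact ⟨hK.span_eq_span_pair_one ha ha_nc fun x hx => pair_eq ▸ mem_of_mem_left x hx,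
    pair_eq ▸ hL.span_eq_span_pair_one hb hb_nc fun y hy => pair_eq ▸ mem_of_mem_right y hy⟩

end CentroidSpan

theorem theoremE {R : Type*} [NonUnitalRing R] [IsPrimeRing R] (m n : ℕ)
    (K : Fin (m + 1) → AddSubgroup R) (L : Fin (n + 1) → AddSubgroup R)
    (hK : ∀ j, IsLieIdeal (K j)) (hK_nc : ∀ j, IsNoncentral (K j))
    (hL : ∀ k, IsLieIdeal (L k)) (hL_nc : ∀ k, IsNoncentral (L k)) :
    addCommutatorSubgroup (prodSubgroups m K) (prodSubgroups n L) = ⊥ ↔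
      ∀ j k, ∀ a ∈ K 0, a ∉ NonUnitalSubring.center R →
        mulCentroid (K 0) = mulCentroid (K j) ∧
        mulCentroid (K j) = mulCentroid (L k) ∧
        (mulCentroid (L k) : Set (Martindale.SymmQuotient R)) = centroidLine a := by
  rw [addCommutatorSubgroup_eq_bot_iff, forall_mem_prodSubgroups_commute_prodSubgroups_iff hK
    (fun j => (hK_nc j).ne_bot) hL fun k => (hL_nc k).ne_bot]
  simp only [mulCentroid_eq_span, toAddSubgroup_inj, coe_toAddSubgroup, coe_centroidLine,
    SetLike.coe_set_eq]
  constructor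
  · intro h j k a ha ha_nc
    obtain ⟨b, hb, hb_nc⟩ := (hK_nc j).exists_notMem
    obtain ⟨c, hc, hc_nc⟩ := (hL_nc k).exists_notMem
    obtain ⟨span_K0, span_Lk⟩ :=
      (hK 0).span_eq_span_pair_one_of_forall_commute (hL k) (h 0 k) ha ha_nc hc hc_nc
    obtain ⟨span_Kj, span_Lk'⟩ :=
      (hK j).span_eq_span_pair_one_of_forall_commute (hL k) (h j k) hb hb_nc hc hc_nc
    have span_Kj_eq := span_Kj.trans span_Lk'.symm
    exact ⟨span_K0.trans (span_Kj_eq.trans span_Lk).symm, span_Kj_eq, span_Lk⟩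
  · intro h j k x hx y hy
    obtain ⟨a, ha, ha_nc⟩ := (hK_nc 0).exists_notMem
    obtain ⟨-, span_Kj, span_Lk⟩ := h j k a ha ha_nc
    exact commute_of_ofRing_mem_span_pair_one
      (span_Kj.trans span_Lk ▸ subset_span (Set.mem_image_of_mem _ hx))
      (span_Lk ▸ subset_span (Set.mem_image_of_mem _ hy))
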